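/- **Theorem.** An optimally resilient ($n=3f+1$), committee-based probabilistic Byzantine reliable broadcast (BRB) does not exist in a fully asynchronous network. Precisely: let $n_c:\mathbb N\to\mathbb N$ satisfy $n_c(f)=o(3f+1)$ as $f\to\infty$, let $\varepsilon<1/5$, and let the set of messages have at least two elements. Then there is $f_0$ such that for all $f\ge f_0$ and every $K\in\mathbb N$ the following holds with $n=3f+1$, $n_c=n_c(f)$. Let $C_1,\dots,C_K$ be committees sampled independently, each uniformly among the $n_c$-element subsets of the $n$ nodes. If, for every set of at most $f$ corrupted nodes, with probability at least $1-\varepsilon$ each of $C_1,\dots,C_K$ contains more than $n_c/2$ honest nodes, then no committee-based protocol with these committees is a probabilistic BRB with success probability $1-\varepsilon$. *Network and adversary.* A static adversary corrupts a set of at most $f$ nodes before the committees are sampled; the committees are public, and are the only randomness of the protocol. Proposals are signed by the designated sender and acknowledgments by the acknowledging node; signatures are transferable, and those of honest nodes cannot be forged. The adversary sees all traffic, may hand any signed item that exists or that corrupted nodes can sign to any node at any time, and decides all delays, but every item sent by an honest node to an honest node is handed over eventually. *Committee-based protocol.* The sender submits its message $m$ to committees of its choice, adaptively, possibly together with acknowledgments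 it has obtained as evidence; a proposal is sent at least to all members of the committee. An honest node acknowledges only proposals that pass a public validity check (which all proposals of an honest sender pass) and that were made to a committee of which it is a member; it acknowledges such a proposal as soon as it has it, unless it has seen a valid proposal of a different message. Acknowledgments given in a committee are sent to a set of recipients fixed by the protocol for that committee. For each message, a node accepts from each committee acknowledgments of members only, and at most a quota of them fixed by the protocol, which is at most $\lfloor n_c/2\rfloor+1$; the first ones to arrive count. Nodes may forward accepted items to any nodes. When a node forwards, proposes or delivers is an arbitrary function of the node, the committees, the list of items it has accepted and, for the sender, its input. *Probabilistic BRB.* For every set of at most $f$ corrupted nodes, every input $m$ of the sender and every adversary, with probability at least $1-\varepsilon$ the execution satisfies: (agreement) if two distinct honest nodes deliver $m'$ and $m''$, then $m'=m''$; (validity) if the sender is honest, all honest nodes eventually deliver $m$; (totality) if an honest node delivers $m'$, all honest nodes eventually deliver $m'$. -/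

import Mathlib

open Filter Asymptotics

namespace CommitteeBRB

/-- The public seed: `K` committees, each a set of exactly `nc` of the `n` nodes. -/
abbrev Seed (n nc K : ℕ) : Type := Fin K → {C : Finset (Fin n) // C.card = nc}

/-- Probability of an event when the seed is uniform, that is, when the `K` committees are sampled
independently, each uniformly among the `nc`-element sets of nodes (without replacement). -/
noncomputable def prob {n nc K : ℕ} (A : Set (Seed n nc K)) : ℝ :=
  (A.ncard : ℝ) / (Nat.card (Seed n nc K) : ℝ)

/-- An acknowledgment of the message `msg`, given as a member of committee number `comm` and signed
by `signer`. -/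
structure Ack (n K : ℕ) (M : Type*) where
  signer : Fin n
  comm : Fin K
  msg : M

/-- What travels on the network. All items are signed: an `ack` by its signer, a proposal by the
designated sender. `prop k m E` submits the message `m` to committee number `k` and carries the
acknowledgments in `E` along as evidence. -/
inductive Item (n K : ℕ) (M : Type*) where
  | prop (k : Fin K) (m : M) (E : Finset (Ack n K M))
  | ack (a : Ack n K M)

/-- A committee-based broadcast protocol for `n` nodes and a designated sender. Nodes are
deterministic given the public seed and react to their log, the list of all items accepted so far.
Acknowledgments are acquired from committees only, and a node takes at most `quota k` of them for a
given message from committee number `k` (see `receive`). -/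
structure Protocol (n nc K : ℕ) (M : Type*) where
  sender : Fin n
  /-- How many acknowledgments (for one message) a node takes from committee number `k`: at most
  the size of a simple majority. -/
  quota : Fin K → ℕ
  quota_le : ∀ k, quota k ≤ nc / 2 + 1
  /-- The nodes to which a proposal for committee `k` is sent: the committee, and possibly more. -/
  audience : Seed n nc K → Fin K → Finset (Fin n)
  committee_subset : ∀ ω k, (ω k).1 ⊆ audience ω k
  /-- The nodes to which members of committee `k` send their acknowledgments
  (e.g. only the sender, or all nodes). -/
  recipients : Seed n nc K → Fin K → Finset (Fin n)
  /-- The proposals that an honest sender with a given input makes when it has a given log: which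
  committees it addresses, and with what evidence. -/
  propose : Seed n nc K → M → List (Item n K M) → Set (Fin K × Finset (Ack n K M))
  /-- The sender can show only acknowledgments that it has obtained. -/
  propose_known : ∀ ω m v k E, (k, E) ∈ propose ω m v → ∀ a ∈ E, Item.ack a ∈ v
  /-- The public check that a proposal has to pass in order to be acknowledged. -/
  valid : Seed n nc K → Fin K → M → Finset (Ack n K M) → Prop
  propose_valid : ∀ ω m v k E, (k, E) ∈ propose ω m v → valid ω k m E
  /-- The acknowledgments that an honest node gives when it has a given log. -/
  acks : Fin n → Seed n nc K → List (Item n K M) → Set (Fin K × M)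
  /-- A node acknowledges only valid proposals made to a committee it belongs to. -/
  acks_sound : ∀ i ω v k m, (k, m) ∈ acks i ω v →
    i ∈ (ω k).1 ∧ ∃ E, Item.prop k m E ∈ v ∧ valid ω k m E
  /-- A member of committee `k` acknowledges a valid proposal as soon as it has it, unless it has
  also seen a valid proposal of a different message (then it may do as it likes). -/
  acks_complete : ∀ i ω v k m E, i ∈ (ω k).1 → Item.prop k m E ∈ v → valid ω k m E →
    (∀ k' m' E', Item.prop k' m' E' ∈ v → valid ω k' m' E' → m' = m) → (k, m) ∈ acks i ω v
  /-- Which accepted items an honest node forwards, and to whom. The `Option M` is the node's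
  input: `some m` for the sender, `none` for all other nodes. -/
  relay : Fin n → Seed n nc K → Option M → List (Item n K M) → Set (Fin n × Item n K M)
  relay_known : ∀ i ω inp v j a, (j, a) ∈ relay i ω inp v → a ∈ v
  /-- Which messages an honest node with a given log delivers. -/
  deliver : Fin n → Seed n nc K → Option M → List (Item n K M) → Set M

/-- The schedule of an execution: in step `t` the network hands an item to a node, or is idle. -/
abbrev Schedule (n K : ℕ) (M : Type*) : Type _ := ℕ → Option (Fin n × Item n K M)

section Execution

variable {n nc K : ℕ} {M : Type*} (P : Protocol n nc K M)

open Classical in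
/-- The log of a node after it is handed an item. Items it has already are ignored; proposals are
accepted; an acknowledgment is accepted if its signer belongs to the committee and fewer than
`quota` acknowledgments of that message were taken from that committee so far. -/
noncomputable def Protocol.receive (ω : Seed n nc K) (v : List (Item n K M)) (a : Item n K M) :
    List (Item n K M) :=
  if a ∈ v then v else
    match a with
    | .prop _ _ _ => v ++ [a]
    | .ack b =>
      if b.signer ∈ (ω b.comm).1 ∧
          (Finset.univ.filter fun q : Fin n => Item.ack ⟨q, b.comm, b.msg⟩ ∈ v).card
            < P.quota b.comm
      then v ++ [a] else v

open Classical in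
/-- The log of every node before step `t`. -/
noncomputable def Protocol.log (ω : Seed n nc K) (S : Schedule n K M) :
    ℕ → Fin n → List (Item n K M)
  | 0, _ => []
  | t + 1, i =>
    match S t with
    | none => Protocol.log ω S t i
    | some (j, a) =>
      if i = j then P.receive ω (Protocol.log ω S t i) a else Protocol.log ω S t i

/-- The input of a node when the sender's input is `m`. -/
def Protocol.input (m : M) (i : Fin n) : Option M := if i = P.sender then some m else none

/-- Node `i`, if honest, has signed the acknowledgment of `m'` in committee `k` by time `t`. -/
def Protocol.Acked (ω : Seed n nc K) (S : Schedule n K M) (t : ℕ) (i : Fin n) (k : Fin K)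
    (m' : M) : Prop :=
  ∃ t' ≤ t, (k, m') ∈ P.acks i ω (P.log ω S t' i)

/-- The sender, if honest with input `m`, has signed the proposal `prop k m' E` by time `t`. -/
def Protocol.Proposed (ω : Seed n nc K) (S : Schedule n K M) (m : M) (t : ℕ) (k : Fin K)
    (m' : M) (E : Finset (Ack n K M)) : Prop :=
  m' = m ∧ ∃ t' ≤ t, (k, E) ∈ P.propose ω m (P.log ω S t' P.sender)

/-- At time `t` the item can be put on the network although the adversary, who controls the nodes
in `F` and all links, cannot forge signatures of honest nodes. -/
def Protocol.Available (F : Finset (Fin n)) (ω : Seed n nc K) (S : Schedule n K M) (m : M)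
    (t : ℕ) : Item n K M → Prop
  | .prop k m' E =>
      (P.sender ∉ F → P.Proposed ω S m t k m' E) ∧
      ∀ a ∈ E, a.signer ∉ F → P.Acked ω S t a.signer a.comm a.msg
  | .ack a => a.signer ∉ F → P.Acked ω S t a.signer a.comm a.msg

/-- In the situation before step `t`, the protocol tells node `i` to send the item `a` to `j`. -/
def Protocol.Sends (ω : Seed n nc K) (S : Schedule n K M) (m : M) (t : ℕ) (i j : Fin n)
    (a : Item n K M) : Prop :=
  (∃ k E, i = P.sender ∧ (k, E) ∈ P.propose ω m (P.log ω S t i) ∧ a = .prop k m E ∧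
    j ∈ P.audience ω k) ∨
  (∃ k m', (k, m') ∈ P.acks i ω (P.log ω S t i) ∧ a = .ack ⟨i, k, m'⟩ ∧
    j ∈ P.recipients ω k) ∨
  (j, a) ∈ P.relay i ω (P.input m i) (P.log ω S t i)

/-- The schedules that an asynchronous network with Byzantine nodes `F` allows, where `m` is the
input of the sender: nothing is forged, and whatever an honest node sends to an honest node is
handed over eventually, after an arbitrary delay chosen by the adversary. -/
def Protocol.Admissible (F : Finset (Fin n)) (ω : Seed n nc K) (m : M) (S : Schedule n K M) :
    Prop :=
  (∀ t j a, S t = some (j, a) → P.Available F ω S m t a) ∧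
  (∀ t i j a, i ∉ F → j ∉ F → P.Sends ω S m t i j a → ∃ t' ≥ t, S t' = some (j, a))

/-- Node `i` (honest) delivers `m'` at some time of the execution. -/
def Protocol.Delivers (ω : Seed n nc K) (S : Schedule n K M) (m : M) (i : Fin n) (m' : M) : Prop :=
  ∃ t, m' ∈ P.deliver i ω (P.input m i) (P.log ω S t i)

/-- Agreement, validity and totality of Byzantine reliable broadcast in one execution. -/
structure Protocol.Reliable (F : Finset (Fin n)) (ω : Seed n nc K) (m : M)
    (S : Schedule n K M) : Prop where
  agreement : ∀ i j m' m'', i ∉ F → j ∉ F → i ≠ j →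
    P.Delivers ω S m i m' → P.Delivers ω S m j m'' → m' = m''
  validity : P.sender ∉ F → ∀ i, i ∉ F → P.Delivers ω S m i m
  totality : ∀ i m', i ∉ F → P.Delivers ω S m i m' → ∀ j, j ∉ F → P.Delivers ω S m j m'

/-- The protocol is a probabilistic Byzantine reliable broadcast in a fully asynchronous network:
for every set of at most `f` statically corrupted nodes, every input, and every adversary (who knows
the public seed), the execution is reliable with probability at least `1 - ε`. -/
def Protocol.IsProbabilisticBRB (f : ℕ) (ε : ℝ) : Prop :=
  ∀ F : Finset (Fin n), F.card ≤ f → ∀ (m : M) (A : Seed n nc K → Schedule n K M),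
    (∀ ω, P.Admissible F ω m (A ω)) → 1 - ε ≤ prob {ω | P.Reliable F ω m (A ω)}

end Execution

/-- Whichever at most `f` nodes are corrupted, with probability at least `1 - ε` the `K` sampled
committees contain a simple majority of honest nodes. -/
def HonestMajority (n nc K f : ℕ) (ε : ℝ) : Prop :=
  ∀ F : Finset (Fin n), F.card ≤ f →
    1 - ε ≤ prob {ω : Seed n nc K | ∀ k, nc < 2 * ((ω k).1 \ F).card}

end CommitteeBRB

/-! A split-brain attack. Partition the nodes into `F`, containing the sender, of size `f`, `B` of
size `f` and `A` of size `f + 1`. With nobody corrupted and input `m₁`, the network may delay every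
acknowledgment by `B` until the recipient's quota is filled: a quota never exceeds a simple
majority, and committees have such a majority outside `B`. Late acknowledgments are then dropped
without a trace, and validity still makes everybody deliver `m₁` (`Protocol.exists_admissible_late`,
`Protocol.IsProbabilisticBRB.late`). The same holds for input `m₂` with `A` late. Now corrupt `F`.
The corrupted nodes play the first execution towards `A`, then the second towards `B`. Neither side
misses anything it would have accepted, no signature of the other side is needed, and agreement
fails (`Protocol.log_restrict`, `Protocol.available_restrict`, `Protocol.exists_not_reliable`). The
set `A` is one node larger than the majority hypothesis covers. Since committees are small compared
to `f`, an exchange argument shows that the extra node costs only `δ / 4` of probability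
(`card_majority_exchange`, `le_prob_majority_insert`). Five events of probability about `1 - ε` are
involved (two majorities, two late executions, reliability under attack); as `5 * ε + δ / 4 < 1`,
they occur together on some seed, a contradiction. -/

namespace CommitteeBRB

/-! ### Causal recursion and enumeration -/

/-- A family of values, each determined by the earlier ones, exists. -/
theorem exists_causal_fixedPoint {X : Type*} [Inhabited X] (Φ : (ℕ → X) → ℕ → X)
    (hΦ : ∀ t S S', (∀ s < t, S s = S' s) → Φ S t = Φ S' t) : ∃ S, ∀ t, S t = Φ S t := by
  -- `G N` has its final values below `N`; the default values from `N` on are never read, by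
  -- causality of `Φ`.
  let G : ℕ → ℕ → X := fun N => N.rec (fun _ => default) fun t S => Function.update S t (Φ S t)
  have hG : ∀ t, G (t + 1) = Function.update (G t) t (Φ (G t) t) := fun t => rfl
  have hstable : ∀ s d, G (s + 1 + d) s = G (s + 1) s := by
    intro s d
    induction d with
    | zero => rfl
    | succ d ih => rw [← add_assoc, hG, Function.update_of_ne (by omega), ih]
  refine ⟨fun t => G (t + 1) t, fun t => ?_⟩
  have h : G (t + 1) t = Φ (G t) t := by rw [hG, Function.update_self]
  simp only [h]
  refine hΦ t _ _ fun s hs => ?_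
  obtain ⟨d, rfl⟩ := Nat.exists_eq_add_of_le (Nat.succ_le_of_lt hs)
  exact hstable s d

/-- Countable sets can be enumerated by a single choice function. -/
theorem exists_enumeration (X : Type*) : ∃ e : Set X → ℕ → Option X,
    (∀ s k x, e s k = some x → x ∈ s) ∧ ∀ s : Set X, s.Countable → ∀ x ∈ s, ∃ k, e s k = some x := by
  have h : ∀ s : Set X, ∃ e : ℕ → Option X,
      (∀ k x, e k = some x → x ∈ s) ∧ (s.Countable → ∀ x ∈ s, ∃ k, e k = some x) := by
    intro s
    by_cases hs : s.Countable
    · have : Countable s := hs.to_subtype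
      let _ := Encodable.ofCountable s
      refine ⟨fun k => (Encodable.decode k : Option s).map Subtype.val, ?_, ?_⟩
      · intro k x hx
        obtain ⟨y, -, rfl⟩ := Option.map_eq_some_iff.1 hx
        exact y.2
      · intro _ x hx
        exact ⟨Encodable.encode (⟨x, hx⟩ : s), by simp⟩
    · exact ⟨fun _ => none, by simp, fun h => absurd h hs⟩
  choose e he using h
  exact ⟨e, fun s => (he s).1, fun s => (he s).2⟩

/-! ### Logs, causality and unforgeability -/

section Execution

variable {n nc K : ℕ} {M : Type*} (P : Protocol n nc K M)

open Classical in
/-- The log contains as many acknowledgments of a message from a committee as a node takes. -/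
def Protocol.Saturated (v : List (Item n K M)) (k : Fin K) (m : M) : Prop :=
  P.quota k ≤ (Finset.univ.filter fun q : Fin n => Item.ack ⟨q, k, m⟩ ∈ v).card

variable {P} {ω : Seed n nc K} {S S' : Schedule n K M} {v w : List (Item n K M)}
  {a x : Item n K M} {t t' : ℕ} {i j : Fin n} {F : Finset (Fin n)} {m : M}

theorem Protocol.Saturated.mono {k : Fin K} {m : M} (h : P.Saturated v k m) (hvw : v ⊆ w) :
    P.Saturated w k m := by
  classical
  refine le_trans h (Finset.card_le_card fun q hq => ?_)
  simp only [Finset.mem_filter, Finset.mem_univ, true_and] at hq ⊢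
  exact hvw hq

theorem Protocol.subset_receive : v ⊆ P.receive ω v a := by
  unfold Protocol.receive
  split_ifs
  · exact List.Subset.refl _
  · cases a with
    | prop k m E => exact List.subset_append_left _ _
    | ack b =>
      dsimp only
      split_ifs
      · exact List.subset_append_left _ _
      · exact List.Subset.refl _

theorem Protocol.mem_receive (h : x ∈ P.receive ω v a) : x ∈ v ∨ x = a := by
  unfold Protocol.receive at h
  split_ifs at h
  · exact Or.inl h
  · cases a with
    | prop k m E => simpa using h
    | ack b =>
      dsimp only at h
      split_ifs at h
      · simpa using h
      · exact Or.inl h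

theorem Protocol.prop_mem_receive {k : Fin K} {m : M} {E : Finset (Ack n K M)} :
    Item.prop k m E ∈ P.receive ω v (.prop k m E) := by
  unfold Protocol.receive
  split_ifs with h
  · exact h
  · simp

theorem Protocol.ack_mem_receive_or_saturated {b : Ack n K M} (hb : b.signer ∈ (ω b.comm).1) :
    Item.ack b ∈ P.receive ω v (.ack b) ∨ P.Saturated v b.comm b.msg := by
  classical
  by_cases hs : P.Saturated v b.comm b.msg
  · exact Or.inr hs
  · left
    unfold Protocol.receive
    split_ifs with h
    · exact h
    · dsimp only
      rw [if_pos ⟨hb, by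
        unfold Protocol.Saturated at hs
        convert not_le.1 hs⟩]
      simp

theorem Protocol.receive_ack_of_saturated {b : Ack n K M} (h : P.Saturated v b.comm b.msg) :
    P.receive ω v (.ack b) = v := by
  classical
  unfold Protocol.receive
  split_ifs with h'
  · rfl
  · dsimp only
    rw [if_neg]
    rintro ⟨-, h2⟩
    refine absurd h (not_le.2 ?_)
    convert h2

theorem Protocol.log_succ_none (h : S t = none) (i : Fin n) :
    P.log ω S (t + 1) i = P.log ω S t i := by
  simp [Protocol.log, h]

theorem Protocol.log_succ_self (h : S t = some (i, a)) :
    P.log ω S (t + 1) i = P.receive ω (P.log ω S t i) a := by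
  simp [Protocol.log, h]

theorem Protocol.log_succ_ne (h : S t = some (j, a)) (hij : i ≠ j) :
    P.log ω S (t + 1) i = P.log ω S t i := by
  simp [Protocol.log, h, hij]

theorem Protocol.log_congr (h : ∀ s < t, S s = S' s) : P.log ω S t = P.log ω S' t := by
  induction t with
  | zero => funext i; simp [Protocol.log]
  | succ t ih =>
    have h1 := ih fun s hs => h s (by omega)
    funext i
    simp [Protocol.log, h1, h t (by omega)]

theorem Protocol.log_subset_succ : P.log ω S t i ⊆ P.log ω S (t + 1) i := by
  rcases hS : S t with _ | ⟨j, a⟩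
  · rw [Protocol.log_succ_none hS]
    exact List.Subset.refl _
  · by_cases hij : i = j
    · subst hij
      rw [Protocol.log_succ_self hS]
      exact Protocol.subset_receive
    · rw [Protocol.log_succ_ne hS hij]
      exact List.Subset.refl _

theorem Protocol.log_mono (h : t ≤ t') : P.log ω S t i ⊆ P.log ω S t' i := by
  induction t', h using Nat.le_induction with
  | base => exact List.Subset.refl _
  | succ t' _ ih => exact List.Subset.trans ih Protocol.log_subset_succ

theorem Protocol.exists_of_mem_log (h : x ∈ P.log ω S t i) : ∃ t' < t, S t' = some (i, x) := by
  induction t with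
  | zero => simp [Protocol.log] at h
  | succ t ih =>
    have key : x ∈ P.log ω S t i ∨ S t = some (i, x) := by
      rcases hS : S t with _ | ⟨j, a⟩
      · rw [Protocol.log_succ_none hS] at h
        exact Or.inl h
      · by_cases hij : i = j
        · subst hij
          rw [Protocol.log_succ_self hS] at h
          rcases Protocol.mem_receive h with h | rfl
          · exact Or.inl h
          · exact Or.inr rfl
        · rw [Protocol.log_succ_ne hS hij] at h
          exact Or.inl h
    rcases key with h | h
    · obtain ⟨t', h1, h2⟩ := ih h
      exact ⟨t', by omega, h2⟩
    · exact ⟨t, by omega, h⟩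

theorem Protocol.Acked.mono {k : Fin K} {m' : M} (h : P.Acked ω S t i k m') (ht : t ≤ t') :
    P.Acked ω S t' i k m' := by
  obtain ⟨s, hs, h⟩ := h
  exact ⟨s, hs.trans ht, h⟩

theorem Protocol.Available.mono (h : P.Available F ω S m t a) (ht : t ≤ t') :
    P.Available F ω S m t' a := by
  cases a with
  | prop k m' E =>
    refine ⟨fun hs => ?_, fun b hb hbF => (h.2 b hb hbF).mono ht⟩
    obtain ⟨h1, s, hs, h2⟩ := h.1 hs
    exact ⟨h1, s, hs.trans ht, h2⟩
  | ack b => exact fun hb => Protocol.Acked.mono (h hb) ht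

theorem Protocol.Acked.congr {k : Fin K} {m' : M} (h : P.Acked ω S t i k m')
    (hS : ∀ s < t, S s = S' s) : P.Acked ω S' t i k m' := by
  obtain ⟨s, hs, h⟩ := h
  exact ⟨s, hs, by rwa [← Protocol.log_congr fun u hu => hS u (by omega)]⟩

theorem Protocol.Available.congr (h : P.Available F ω S m t a) (hS : ∀ s < t, S s = S' s) :
    P.Available F ω S' m t a := by
  cases a with
  | prop k m' E =>
    refine ⟨fun hs => ?_, fun b hb hbF => (h.2 b hb hbF).congr hS⟩
    obtain ⟨h1, s, hs, h2⟩ := h.1 hs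
    exact ⟨h1, s, hs, by rwa [← Protocol.log_congr fun u hu => hS u (by omega)]⟩
  | ack b => exact fun hb => Protocol.Acked.congr (h hb) hS

/-- What an honest node sends is not forged, if nothing was forged before. -/
theorem Protocol.Sends.available (h : P.Sends ω S m t i j a) (hi : i ∉ F)
    (hS : ∀ s < t, ∀ j a, S s = some (j, a) → P.Available F ω S m s a) :
    P.Available F ω S m t a := by
  have hlog : ∀ i, ∀ x ∈ P.log ω S t i, P.Available F ω S m t x := by
    intro i x hx
    obtain ⟨s, hs, hx⟩ := Protocol.exists_of_mem_log hx
    exact (hS s hs _ _ hx).mono hs.le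
  rcases h with ⟨k, E, rfl, hE, rfl, -⟩ | ⟨k, m', hk, rfl, -⟩ | h
  · exact ⟨fun _ => ⟨rfl, t, le_rfl, hE⟩,
      fun b hb hbF => hlog _ _ (P.propose_known _ _ _ _ _ hE b hb) hbF⟩
  · exact fun _ => ⟨t, le_rfl, hk⟩
  · exact hlog i a (P.relay_known _ _ _ _ _ _ h)

/-! ### Fair schedules and late acknowledgments -/

/-- `M` may be uncountable, but everything sent derives from finite logs: evidence is a subset of
the sender's log, and an acknowledged message occurs in a logged proposal. Countability lets a
scheduler try every item. -/
theorem Protocol.countable_sends (P : Protocol n nc K M) (ω : Seed n nc K) (S : Schedule n K M)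
    (m : M) (t : ℕ) (F : Finset (Fin n)) :
    {p : Fin n × Item n K M | p.1 ∉ F ∧ ∃ i ∉ F, P.Sends ω S m t i p.1 p.2}.Countable := by
  have hfin : ∀ v : List (Item n K M), {a | Item.ack a ∈ v}.Finite := by
    intro v
    refine Set.Finite.preimage (fun a _ b _ h => ?_) (List.finite_toSet v)
    exact Item.ack.inj h
  have hprop : (⋃ k : Fin K, (fun E => Item.prop k m E) ''
      {E : Finset (Ack n K M) | (E : Set _) ⊆ {a | Item.ack a ∈ P.log ω S t P.sender}}).Countable := by
    refine Set.countable_iUnion fun k => Set.Countable.image (Set.Finite.countable ?_) _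
    refine Set.Finite.of_injOn (f := fun E : Finset (Ack n K M) => (E : Set (Ack n K M)))
      (fun E hE => ?_) (fun _ _ _ _ h => Finset.coe_injective h) (hfin (P.log ω S t P.sender)).finite_subsets
    exact hE
  have hack : (⋃ i : Fin n, ⋃ k : Fin K, ⋃ x ∈ {x | x ∈ P.log ω S t i},
      {a : Item n K M | ∃ m' E, x = Item.prop k m' E ∧ a = .ack ⟨i, k, m'⟩}).Countable := by
    refine Set.countable_iUnion fun i => Set.countable_iUnion fun k =>
      (List.finite_toSet _).countable.biUnion fun x _ => Set.Subsingleton.countable ?_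
    rintro a ⟨m1, E1, rfl, rfl⟩ b ⟨m2, E2, h, rfl⟩
    injection h with h1 h2 h3
    rw [h2]
  have hrel : (⋃ i : Fin n, {x | x ∈ P.log ω S t i}).Countable :=
    Set.countable_iUnion fun i => (List.finite_toSet _).countable
  refine Set.Countable.mono ?_
    (Set.Countable.prod (Set.countable_univ (α := Fin n)) ((hprop.union hack).union hrel))
  rintro ⟨j, a⟩ ⟨-, i, -, h⟩
  refine ⟨trivial, ?_⟩
  rcases h with ⟨k, E, rfl, hE, h, -⟩ | ⟨k, m', hk, h, -⟩ | h
  · refine Or.inl (Or.inl (Set.mem_iUnion.2 ⟨k, E, fun b hb => ?_, h.symm⟩))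
    exact P.propose_known _ _ _ _ _ hE b hb
  · obtain ⟨-, E, hE, -⟩ := P.acks_sound _ _ _ _ _ hk
    refine Or.inl (Or.inr ?_)
    simp only [Set.mem_iUnion]
    exact ⟨i, k, _, hE, m', E, rfl, h⟩
  · exact Or.inr (Set.mem_iUnion.2 ⟨i, P.relay_known _ _ _ _ _ _ h⟩)

theorem Protocol.Sends.congr (h : P.Sends ω S m t i j a) (hS : ∀ s < t, S s = S' s) :
    P.Sends ω S' m t i j a := by
  unfold Protocol.Sends at h ⊢
  rwa [← Protocol.log_congr hS]

/-- A fair scheduler: it extends a given finite execution, then hands over only what honest nodes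
have sent to honest nodes and what the filter `ok` lets pass, and tries each such item over and
over. -/
theorem Protocol.exists_fair_schedule (P : Protocol n nc K M) (ω : Seed n nc K) (m : M)
    (F : Finset (Fin n)) (ok : List (Item n K M) → Item n K M → Prop) (S₀ : Schedule n K M)
    (T : ℕ) : ∃ S : Schedule n K M, (∀ t < T, S t = S₀ t) ∧
      (∀ t ≥ T, ∀ j a, S t = some (j, a) → ok (P.log ω S t j) a ∧
        ∃ s ≤ t, ∃ i ∉ F, P.Sends ω S m s i j a) ∧
      (∀ t i j a, i ∉ F → j ∉ F → P.Sends ω S m t i j a →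
        ∀ t₀, ∃ t' ≥ t₀, ok (P.log ω S t' j) a → S t' = some (j, a)) := by
  classical
  obtain ⟨e, he, he'⟩ := exists_enumeration (Fin n × Item n K M)
  let X : Schedule n K M → ℕ → Set (Fin n × Item n K M) := fun S t =>
    {p | p.1 ∉ F ∧ ∃ i ∉ F, P.Sends ω S m t i p.1 p.2}
  have hX : ∀ t S S', (∀ s < t, S s = S' s) → X S t = X S' t := by
    intro t S S' h
    ext p
    exact ⟨fun ⟨h1, i, hi, h2⟩ => ⟨h1, i, hi, h2.congr h⟩,
      fun ⟨h1, i, hi, h2⟩ => ⟨h1, i, hi, h2.congr fun s hs => (h s hs).symm⟩⟩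
  -- Step `t = pair s (pair k r)` tries the `k`-th item sent at time `s`; varying `r` repeats each
  -- attempt forever. Since `s ≤ t`, and `e` depends only on the set of items sent, the rule is
  -- causal.
  let Φ : Schedule n K M → ℕ → Option (Fin n × Item n K M) := fun S t =>
    if t < T then S₀ t else
      (e (X S t.unpair.1) t.unpair.2.unpair.1).filter fun p => ok (P.log ω S t p.1) p.2
  obtain ⟨S, hS⟩ := exists_causal_fixedPoint Φ (by
    intro t S S' h
    have h1 := Nat.unpair_left_le t
    simp only [Φ, hX t.unpair.1 S S' fun s hs => h s (by omega),
      Protocol.log_congr (P := P) (ω := ω) h])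
  refine ⟨S, fun t ht => ?_, fun t ht j a h => ?_, fun t i j a hi hj h t₀ => ?_⟩
  · rw [hS]
    simp [Φ, ht]
  · rw [hS] at h
    simp only [Φ, if_neg (not_lt.2 ht), Option.filter_eq_some_iff, decide_eq_true_eq] at h
    obtain ⟨-, i, hi, h2⟩ := he _ _ _ h.1
    exact ⟨h.2, _, Nat.unpair_left_le t, i, hi, h2⟩
  · obtain ⟨k, hk⟩ := he' (X S t) (P.countable_sends ω S m t F) (j, a) ⟨hj, i, hi, h⟩
    have h1 : T + t₀ ≤ Nat.pair t (Nat.pair k (T + t₀)) :=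
      (Nat.right_le_pair _ _).trans (Nat.right_le_pair _ _)
    refine ⟨Nat.pair t (Nat.pair k (T + t₀)), by omega, fun hok => ?_⟩
    rw [hS]
    simp only [Φ]
    rw [if_neg (by omega)]
    simp only [Nat.unpair_pair, hk]
    simpa [Option.filter_eq_some_iff] using hok

theorem Protocol.available_of_forall_sends (T : ℕ)
    (hT : ∀ t < T, ∀ j a, S t = some (j, a) → P.Available F ω S m t a)
    (h : ∀ t ≥ T, ∀ j a, S t = some (j, a) → ∃ s ≤ t, ∃ i ∉ F, P.Sends ω S m s i j a) :
    ∀ t j a, S t = some (j, a) → P.Available F ω S m t a := by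
  intro t
  induction t using Nat.strong_induction_on with
  | _ t ih =>
    intro j a hja
    by_cases ht : t < T
    · exact hT t ht j a hja
    · obtain ⟨s, hs, i, hi, h1⟩ := h t (by omega) j a hja
      exact (h1.available hi fun u hu => ih u (by omega)).mono hs

/-- Every finite execution without forgery extends to an admissible one. -/
theorem Protocol.exists_admissible_extension (P : Protocol n nc K M) (ω : Seed n nc K) (m : M)
    (F : Finset (Fin n)) (S₀ : Schedule n K M) (T : ℕ)
    (h₀ : ∀ t < T, ∀ j a, S₀ t = some (j, a) → P.Available F ω S₀ m t a) :
    ∃ S, P.Admissible F ω m S ∧ ∀ t < T, S t = S₀ t := by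
  obtain ⟨S, h1, h2, h3⟩ := P.exists_fair_schedule ω m F (fun _ _ => True) S₀ T
  refine ⟨S, ⟨Protocol.available_of_forall_sends T (fun t ht j a h => ?_)
    fun t ht j a h => (h2 t ht j a h).2, fun t i j a hi hj h => ?_⟩, h1⟩
  · exact (h₀ t ht j a (h1 t ht ▸ h)).congr fun s hs => (h1 s (by omega)).symm
  · obtain ⟨t', ht', h'⟩ := h3 t i j a hi hj h t
    exact ⟨t', ht', h' trivial⟩

theorem Protocol.exists_admissible (P : Protocol n nc K M) (ω : Seed n nc K) (m : M)
    (F : Finset (Fin n)) : ∃ S, P.Admissible F ω m S := by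
  obtain ⟨S, hS, -⟩ := P.exists_admissible_extension ω m F (fun _ => none) 0 (by simp)
  exact ⟨S, hS⟩

theorem Protocol.Available.prop_eq {k : Fin K} {m' : M} {E : Finset (Ack n K M)}
    (h : P.Available ∅ ω S m t (.prop k m' E)) :
    m' = m ∧ ∃ s ≤ t, (k, E) ∈ P.propose ω m (P.log ω S s P.sender) :=
  h.1 (Finset.notMem_empty _)

/-- If all nodes are honest and the nodes outside `L` form a majority of every committee, then the
network can make all acknowledgments of nodes in `L` arrive too late to be accepted. -/
theorem Protocol.exists_admissible_late (P : Protocol n nc K M) (ω : Seed n nc K) (m : M)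
    (L : Finset (Fin n)) (hL : ∀ k, nc < 2 * ((ω k).1 \ L).card) :
    ∃ S, P.Admissible ∅ ω m S ∧ ∀ t i b, b.signer ∈ L → Item.ack b ∉ P.log ω S t i := by
  classical
  -- The filter lets an acknowledgment by `L` through only when its recipient will ignore it. What
  -- has to be shown is that this moment always comes.
  obtain ⟨S, -, h2, h3⟩ := P.exists_fair_schedule ω m ∅
    (fun v a => ∀ b, a = Item.ack b → b.signer ∈ L → P.receive ω v a = v) (fun _ => none) 0
  have hav := Protocol.available_of_forall_sends (P := P) (ω := ω) (S := S) (m := m) (F := ∅) 0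
    (by simp) fun t ht j a h => (h2 t ht j a h).2
  have hlate : ∀ t i b, b.signer ∈ L → Item.ack b ∉ P.log ω S t i := by
    intro t i b hb
    induction t with
    | zero => simp [Protocol.log]
    | succ t ih =>
      rcases hS : S t with _ | ⟨j, a⟩
      · rwa [Protocol.log_succ_none hS]
      · by_cases hij : i = j
        · subst hij
          rw [Protocol.log_succ_self hS]
          intro hmem
          rcases Protocol.mem_receive hmem with h | h
          · exact ih h
          · rw [(h2 t (Nat.zero_le _) _ _ hS).1 b h.symm hb] at hmem
            exact ih hmem
        · rwa [Protocol.log_succ_ne hS hij]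
  have hlog : ∀ t i x, x ∈ P.log ω S t i → P.Available ∅ ω S m t x := by
    intro t i x hx
    obtain ⟨s, hs, h⟩ := Protocol.exists_of_mem_log hx
    exact (hav s _ _ h).mono hs.le
  have hnotL : ∀ t i j a, (∀ b, a = Item.ack b → b.signer ∉ L) → P.Sends ω S m t i j a →
      ∃ t' ≥ t, S t' = some (j, a) := by
    intro t i j a ha h
    obtain ⟨t', ht', h'⟩ := h3 t i j a (Finset.notMem_empty _) (Finset.notMem_empty _) h t
    exact ⟨t', ht', h' fun b hb hbL => absurd hbL (ha b hb)⟩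
  refine ⟨S, ⟨hav, fun t i j a _ _ hs => ?_⟩, hlate⟩
  by_cases ha : ∀ b, a = Item.ack b → b.signer ∉ L
  · exact hnotL t i j a ha hs
  push Not at ha
  obtain ⟨b, rfl, hbL⟩ := ha
  have hs' := hs
  rcases hs' with ⟨k, E, -, -, h, -⟩ | ⟨k, m', hk, hb, hj⟩ | h
  · cases h
  · obtain ⟨-, E, hE, hval⟩ := P.acks_sound _ _ _ _ _ hk
    obtain ⟨rfl, s, -, hprop⟩ := (hlog _ _ _ hE).prop_eq
    have hbeq : b = ⟨i, k, m'⟩ := Item.ack.inj hb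
    have key : ∀ q ∈ (ω k).1 \ L, ∃ t₁, ∀ t₂ ≥ t₁,
        P.Saturated (P.log ω S t₂ j) k m' ∨ Item.ack ⟨q, k, m'⟩ ∈ P.log ω S t₂ j := by
      intro q hq
      obtain ⟨hqC, hqL⟩ := Finset.mem_sdiff.1 hq
      obtain ⟨t₁, -, h₁⟩ := hnotL s P.sender q (.prop k m' E) (by simp)
        (Or.inl ⟨k, E, rfl, hprop, rfl, P.committee_subset ω k hqC⟩)
      have hmem : Item.prop k m' E ∈ P.log ω S (t₁ + 1) q := by
        rw [Protocol.log_succ_self h₁]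
        exact Protocol.prop_mem_receive
      -- The honest sender signs proposals of `m` only, so no conflicting proposal excuses `q` from
      -- acknowledging.
      have hack : (k, m') ∈ P.acks q ω (P.log ω S (t₁ + 1) q) :=
        P.acks_complete q ω _ k m' E hqC hmem hval fun k₂ m₂ E₂ hE₂ _ => (hlog _ _ _ hE₂).prop_eq.1
      obtain ⟨t₂, -, h₂⟩ := hnotL (t₁ + 1) q j (.ack ⟨q, k, m'⟩)
        (by rintro b hb; cases hb; exact hqL) (Or.inr (Or.inl ⟨k, m', hack, rfl, hj⟩))
      refine ⟨t₂ + 1, fun t₃ ht₃ => ?_⟩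
      rcases Protocol.ack_mem_receive_or_saturated (P := P) (v := P.log ω S t₂ j)
        (b := ⟨q, k, m'⟩) hqC with h | h
      · rw [← Protocol.log_succ_self h₂] at h
        exact Or.inr (Protocol.log_mono ht₃ h)
      · exact Or.inl (h.mono (Protocol.log_mono (by omega)))
    choose! τ hτ using key
    -- Past the supremum of all `τ q`, node `j` has either filled its quota or accepted every
    -- acknowledgment from outside `L`; the latter are more than half of the committee, so they fill
    -- the quota too.
    obtain ⟨t', ht', h'⟩ := h3 t i j _ (Finset.notMem_empty _) (Finset.notMem_empty _) hs
      (t + ((ω k).1 \ L).sup τ)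
    refine ⟨t', by omega, h' fun b' hb' _ => ?_⟩
    rw [hbeq]
    refine Protocol.receive_ack_of_saturated ?_
    by_contra hsat
    have hcard : ((ω k).1 \ L).card ≤
        (Finset.univ.filter fun q : Fin n => Item.ack ⟨q, k, m'⟩ ∈ P.log ω S t' j).card := by
      refine Finset.card_le_card fun q hq => ?_
      have hle : τ q ≤ ((ω k).1 \ L).sup τ := Finset.le_sup hq
      have := (hτ q hq t' (by omega)).resolve_left hsat
      simpa using this
    refine hsat (show P.quota k ≤ _ from ?_)
    have h1 := P.quota_le k
    have h2 := hL k
    refine le_trans ?_ hcard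
    omega
  -- Only accepted items are forwarded, and acknowledgments by `L` never are accepted.
  · exact absurd (P.relay_known _ _ _ _ _ _ h) (hlate t i b hbL)

end Execution

/-! ### Cost of one more node outside the majority -/

section Probability

variable {n nc K : ℕ}

theorem prob_empty : prob (∅ : Set (Seed n nc K)) = 0 := by
  simp [prob]

theorem prob_le_one (A : Set (Seed n nc K)) : prob A ≤ 1 := by
  unfold prob
  refine div_le_one_of_le₀ ?_ (by positivity)
  exact_mod_cast Set.ncard_le_card A

theorem prob_add_le (A B : Set (Seed n nc K)) : prob A + prob B ≤ 1 + prob (A ∩ B) := by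
  have h := Set.ncard_union_add_ncard_inter A B
  have h' : prob (A ∪ B) + prob (A ∩ B) = prob A + prob B := by
    unfold prob
    rw [← add_div, ← add_div]
    congr 1
    exact_mod_cast h
  linarith [prob_le_one (A ∪ B)]

/-- The committees are independent and identically distributed. -/
theorem prob_forall (G : Set {C : Finset (Fin n) // C.card = nc}) :
    prob {ω : Seed n nc K | ∀ k, ω k ∈ G} =
      ((G.ncard : ℝ) / (Nat.card {C : Finset (Fin n) // C.card = nc} : ℝ)) ^ K := by
  have h : {ω : Seed n nc K | ∀ k, ω k ∈ G}.ncard = G.ncard ^ K := by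
    have e : {ω : Seed n nc K | ∀ k, ω k ∈ G} ≃ (Fin K → G) :=
      { toFun := fun ω k => ⟨ω.1 k, ω.2 k⟩
        invFun := fun g => ⟨fun k => (g k).1, fun k => (g k).2⟩
        left_inv := fun _ => rfl
        right_inv := fun _ => rfl }
    rw [← Nat.card_coe_set_eq, Nat.card_congr e, Nat.card_fun, Nat.card_coe_set_eq]
    simp
  unfold prob
  rw [h, div_pow, Nat.card_fun]
  simp

/-- Exchanging `z` for an element of `A`: there are few sets for which it matters whether `z` is
counted to `A`, compared to those with many elements in `A`. -/
theorem card_majority_exchange (A : Finset (Fin n)) (z : Fin n) :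
    (Finset.univ.filter fun C : Finset (Fin n) => C.card = nc ∧ nc < 2 * (C \ A).card ∧
      2 * (C \ insert z A).card ≤ nc).card * (A.card - nc) ≤
    (Finset.univ.filter fun C : Finset (Fin n) => C.card = nc ∧ 2 * (C \ A).card ≤ nc).card * nc := by
  classical
  have hzC : ∀ C : Finset (Fin n), nc < 2 * (C \ A).card → 2 * (C \ insert z A).card ≤ nc →
      z ∈ C := by
    intro C h1 h2
    by_contra hzC
    have : C \ insert z A = C \ A := by
      ext x
      simp only [Finset.mem_sdiff, Finset.mem_insert, not_or]
      exact ⟨fun h => ⟨h.1, h.2.2⟩, fun h => ⟨h.1, fun hx => hzC (hx ▸ h.1), h.2⟩⟩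
    rw [this] at h2
    omega
  -- Double counting of the swaps of `z` for some `a ∈ A \ C`. Each `C` admits at least `A.card -
  -- nc` of them, and the result has no majority outside `A`; conversely `C` is recovered from `C'`
  -- by choosing which of its `nc` elements to turn back into `z`.
  refine Finset.card_mul_le_card_mul
    (fun C C' => ∃ a ∈ A \ C, C' = insert a (C.erase z)) (fun C hC => ?_) (fun C' hC' => ?_)
  · simp only [Finset.mem_filter, Finset.mem_univ, true_and] at hC
    obtain ⟨hcard, h1, h2⟩ := hC
    have hz' := hzC C h1 h2
    have hle : A.card - nc ≤ (A \ C).card := by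
      rw [← hcard]
      exact Finset.le_card_sdiff C A
    refine hle.trans (Finset.card_le_card_of_injOn (fun a => insert a (C.erase z)) ?_ ?_)
    · intro a ha
      have ha' := Finset.mem_sdiff.1 ha
      have hset : insert a (C.erase z) \ A = C \ insert z A := by
        ext x
        simp only [Finset.mem_sdiff, Finset.mem_insert, Finset.mem_erase, not_or]
        constructor
        · rintro ⟨rfl | h, hx⟩
          · exact absurd ha'.1 hx
          · exact ⟨h.2, h.1, hx⟩
        · rintro ⟨h1, h2, h3⟩
          exact ⟨Or.inr ⟨h2, h1⟩, h3⟩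
      have hc : (insert a (C.erase z)).card = nc := by
        rw [Finset.card_insert_of_notMem (fun h => ha'.2 (Finset.mem_of_mem_erase h)),
          Finset.card_erase_add_one hz', hcard]
      simp only [Finset.mem_coe, Finset.mem_bipartiteAbove, Finset.mem_filter, Finset.mem_univ,
        true_and]
      exact ⟨⟨hc, by rw [hset]; exact h2⟩, a, ha, rfl⟩
    · intro a ha b hb hab
      have ha' := (Finset.mem_sdiff.1 (Finset.mem_coe.1 ha)).2
      have : a ∈ insert b (C.erase z) := by
        rw [← show insert a (C.erase z) = insert b (C.erase z) from hab]
        exact Finset.mem_insert_self a _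
      rcases Finset.mem_insert.1 this with h | h
      · exact h
      · exact absurd (Finset.mem_of_mem_erase h) ha'
  · simp only [Finset.mem_filter, Finset.mem_univ, true_and] at hC'
    refine le_trans (Finset.card_le_card (t := C'.image fun a => insert z (C'.erase a)) ?_)
      (Finset.card_image_le.trans_eq hC'.1)
    intro C hC
    simp only [Finset.mem_bipartiteBelow, Finset.mem_filter, Finset.mem_univ, true_and] at hC
    obtain ⟨⟨-, h1, h2⟩, a, ha, rfl⟩ := hC
    refine Finset.mem_image.2 ⟨a, Finset.mem_insert_self _ _, ?_⟩
    rw [Finset.erase_insert fun h => (Finset.mem_sdiff.1 ha).2 (Finset.mem_of_mem_erase h),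
      Finset.insert_erase (hzC C h1 h2)]

theorem ncard_committee (p : Finset (Fin n) → Prop) [DecidablePred p] :
    {C : {C : Finset (Fin n) // C.card = nc} | p C.1}.ncard =
      (Finset.univ.filter fun C : Finset (Fin n) => C.card = nc ∧ p C).card := by
  rw [← Set.ncard_image_of_injective _ Subtype.val_injective, ← Set.ncard_coe_finset]
  congr 1
  ext C
  simp [and_comm]

/-- A loss of `b` in one factor from `[0, 1]` costs the product at most `b`, so `k` losses cost at
most `k * b`. -/
theorem pow_sub_mul_le_pow {a a' b : ℝ} (ha : 0 ≤ a) (ha1 : a ≤ 1) (ha' : 0 ≤ a') (hb : 0 ≤ b)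
    (h : a - b ≤ a') (k : ℕ) : a ^ k - k * b ≤ a' ^ k := by
  induction k with
  | zero => simp
  | succ k ih =>
    have h0 : 0 ≤ a ^ k := pow_nonneg ha k
    have h1 : a ^ k ≤ 1 := pow_le_one₀ ha ha1
    have hk : (0 : ℝ) ≤ k := Nat.cast_nonneg k
    have hkb : 0 ≤ k * b := mul_nonneg hk hb
    rw [pow_succ, pow_succ]
    push_cast
    rcases le_total (a ^ k - k * b) 0 with hneg | hpos
    · have : 0 ≤ a' ^ k * a' := by positivity
      nlinarith
    · have h2 : (a ^ k - k * b) * (a - b) ≤ (a ^ k - k * b) * a' :=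
        mul_le_mul_of_nonneg_left h hpos
      have h3 : (a ^ k - k * b) * a' ≤ a' ^ k * a' := mul_le_mul_of_nonneg_right ih ha'
      nlinarith [mul_nonneg hkb hb, mul_nonneg hkb (sub_nonneg.2 ha1), mul_nonneg hb (sub_nonneg.2 h1)]

/-- Since `(1 - p) * (1 + p) ≤ 1`, the hypothesis forces `(1 + p) ^ k ≤ 5 / 4`, and Bernoulli's
inequality applies. -/
theorem mul_le_of_le_one_sub_pow {p : ℝ} (hp0 : 0 ≤ p) (hp1 : p ≤ 1) (k : ℕ)
    (h : 4 / 5 ≤ (1 - p) ^ k) : k * p ≤ 1 / 4 := by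
  have h1 : 1 + k * p ≤ (1 + p) ^ k := one_add_mul_le_pow (by linarith) k
  have h2 : (1 - p) ^ k * (1 + p) ^ k ≤ 1 := by
    rw [← mul_pow]
    exact pow_le_one₀ (by nlinarith) (by nlinarith)
  have hkp : 0 ≤ k * p := by positivity
  nlinarith

/-- A slight strengthening of an honest majority: one more node may be removed. -/
theorem le_prob_majority_insert {f : ℕ} {ε δ : ℝ} (hε : ε < 1 / 5)
    (A : Finset (Fin n)) (hA : A.card = f) (z : Fin n) (hδ : 0 ≤ δ)
    (hnc : (nc : ℝ) ≤ δ * (f - nc)) (hncf : nc < f)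
    (h : 1 - ε ≤ prob {ω : Seed n nc K | ∀ k, nc < 2 * ((ω k).1 \ A).card}) :
    1 - ε - δ / 4 ≤ prob {ω : Seed n nc K | ∀ k, nc < 2 * ((ω k).1 \ insert z A).card} := by
  classical
  let T := {C : Finset (Fin n) // C.card = nc}
  let G : Set T := {C | nc < 2 * (C.1 \ A).card}
  let G' : Set T := {C | nc < 2 * (C.1 \ insert z A).card}
  let Q : Set T := {C | nc < 2 * (C.1 \ A).card ∧ 2 * (C.1 \ insert z A).card ≤ nc}
  let B : Set T := {C | 2 * (C.1 \ A).card ≤ nc}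
  have e1 : prob {ω : Seed n nc K | ∀ k, nc < 2 * ((ω k).1 \ A).card} =
    ((G.ncard : ℝ) / (Nat.card T : ℝ)) ^ K := prob_forall G
  have e2 : prob {ω : Seed n nc K | ∀ k, nc < 2 * ((ω k).1 \ insert z A).card} =
    ((G'.ncard : ℝ) / (Nat.card T : ℝ)) ^ K := prob_forall G'
  have hQB : Q.ncard * (f - nc) ≤ B.ncard * nc := by
    have := card_majority_exchange (nc := nc) A z
    rw [hA] at this
    simp only [Q, B, T]
    rw [ncard_committee fun C => nc < 2 * (C \ A).card ∧ 2 * (C \ insert z A).card ≤ nc,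
      ncard_committee fun C => 2 * (C \ A).card ≤ nc]
    exact this
  have hGB : G.ncard + B.ncard = Nat.card T := by
    have : B = Gᶜ := by
      ext C
      simp [G, B]
    rw [this, Set.ncard_add_ncard_compl]
  have hGQ : G.ncard ≤ G'.ncard + Q.ncard := by
    refine le_trans (Set.ncard_le_ncard (t := G' ∪ Q) fun C hC => ?_) (Set.ncard_union_le _ _)
    by_cases h : nc < 2 * (C.1 \ insert z A).card
    · exact Or.inl h
    · exact Or.inr ⟨hC, not_lt.1 h⟩
  have hT : 0 < Nat.card T := by
    have : Finite T := inferInstance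
    have hn : f ≤ n := by
      rw [← hA]
      simpa using Finset.card_le_univ A
    obtain ⟨C, -, hC⟩ := Finset.exists_subset_card_eq (s := (Finset.univ : Finset (Fin n))) (n := nc)
      (by simp; omega)
    have : Nonempty T := ⟨⟨C, hC⟩⟩
    exact Nat.card_pos
  rw [e1] at h
  rw [e2]
  have hN : (0 : ℝ) < Nat.card T := by exact_mod_cast hT
  have hGB' : (G.ncard : ℝ) + B.ncard = Nat.card T := by exact_mod_cast hGB
  have hGQ' : (G.ncard : ℝ) ≤ G'.ncard + Q.ncard := by exact_mod_cast hGQ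
  have hQB' : (Q.ncard : ℝ) * (f - nc) ≤ B.ncard * nc := by
    have : ((Q.ncard * (f - nc) : ℕ) : ℝ) ≤ ((B.ncard * nc : ℕ) : ℝ) := by exact_mod_cast hQB
    rw [Nat.cast_mul, Nat.cast_sub hncf.le, Nat.cast_mul] at this
    exact this
  have hfn : (0 : ℝ) < f - nc := by
    have : (nc : ℝ) < f := by exact_mod_cast hncf
    linarith
  have hB0 : (0 : ℝ) ≤ B.ncard := Nat.cast_nonneg _
  have hQδ : (Q.ncard : ℝ) ≤ δ * B.ncard := by
    have : (Q.ncard : ℝ) * (f - nc) ≤ (δ * B.ncard) * (f - nc) := by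
      nlinarith [mul_le_mul_of_nonneg_left hnc hB0]
    exact le_of_mul_le_mul_right this hfn
  -- `p` is the probability that one committee lacks a majority outside `A`; counting `z` to `A`
  -- raises it by at most `δ * p`. As `(1 - p) ^ K ≥ 1 - ε ≥ 4 / 5`, the total loss `K * δ * p` is
  -- at most `δ / 4`, whatever `K` is.
  set p : ℝ := B.ncard / Nat.card T with hp
  have hp0 : 0 ≤ p := by positivity
  have hg : (G.ncard : ℝ) / Nat.card T = 1 - p := by
    rw [hp, ← hGB']
    rw [← hGB'] at hN
    field_simp
    ring
  have hg0 : (0 : ℝ) ≤ (G.ncard : ℝ) / Nat.card T := by positivity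
  rw [hg] at h hg0
  have hKp := mul_le_of_le_one_sub_pow hp0 (by linarith) K (by linarith)
  have hstep : (1 - p) - δ * p ≤ (G'.ncard : ℝ) / Nat.card T := by
    rw [← hg, hp, ← mul_div_assoc, ← sub_div]
    gcongr
    linarith
  have := pow_sub_mul_le_pow hg0 (by linarith) (by positivity) (mul_nonneg hδ hp0) hstep K
  nlinarith

end Probability

/-! ### The split-brain attack -/

section Attack

variable {n nc K : ℕ} {M : Type*}

open Classical in
/-- An execution restricted to what is handed to the nodes in `A`, without the acknowledgments of
the nodes in `B`. -/
noncomputable def restrict (S : Schedule n K M) (A B : Finset (Fin n)) : Schedule n K M :=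
  fun t => (S t).filter fun p => p.1 ∈ A ∧ ∀ b, p.2 = Item.ack b → b.signer ∉ B

variable {P : Protocol n nc K M} {ω : Seed n nc K} {S S' : Schedule n K M} {A B : Finset (Fin n)}
  {t T T₀ : ℕ} {i j : Fin n} {a : Item n K M} {F : Finset (Fin n)} {m m' : M}

theorem restrict_eq_some : restrict S A B t = some (j, a) ↔
    S t = some (j, a) ∧ j ∈ A ∧ ∀ b, a = Item.ack b → b.signer ∉ B := by
  simp [restrict, Option.filter_eq_some_iff]

theorem Protocol.log_eq_nil (h : ∀ t < T, ∀ a, S t ≠ some (i, a)) : P.log ω S T i = [] := by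
  rw [List.eq_nil_iff_forall_not_mem]
  intro x hx
  obtain ⟨t, ht, h'⟩ := Protocol.exists_of_mem_log hx
  exact h t ht x h'

/-- If acknowledgments of `B` are never accepted, then nodes in `A` do not notice the
restriction. -/
theorem Protocol.log_restrict (hB : ∀ t i b, b.signer ∈ B → Item.ack b ∉ P.log ω S t i)
    (h₀ : P.log ω S' T₀ i = []) (hS' : ∀ t < T, S' (T₀ + t) = restrict S A B t)
    (hi : i ∈ A) (ht : t ≤ T) : P.log ω S' (T₀ + t) i = P.log ω S t i := by
  induction t with
  | zero => simpa [Protocol.log] using h₀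
  | succ t ih =>
    have ih' := ih (by omega)
    have ht' := hS' t (by omega)
    rw [← add_assoc]
    rcases hS : S t with _ | ⟨j, a⟩
    · rw [Protocol.log_succ_none hS, Protocol.log_succ_none (by rw [ht']; simp [restrict, hS]), ih']
    · by_cases hij : i = j
      · subst hij
        rw [Protocol.log_succ_self hS]
        by_cases ha : ∀ b, a = Item.ack b → b.signer ∉ B
        · rw [Protocol.log_succ_self (ht'.trans (restrict_eq_some.2 ⟨hS, hi, ha⟩)), ih']
        · have hnone : restrict S A B t = none := by
            rw [Option.eq_none_iff_forall_ne_some]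
            rintro ⟨j, a'⟩ h
            obtain ⟨h1, -, h2⟩ := restrict_eq_some.1 h
            rw [hS] at h1
            cases h1
            exact ha h2
          rw [Protocol.log_succ_none (ht'.trans hnone), ih']
          push Not at ha
          obtain ⟨b, rfl, hb⟩ := ha
          -- The withheld acknowledgment was not accepted in `S` either, so handing it over there
          -- left the log unchanged.
          have hnot := hB (t + 1) i b hb
          rw [Protocol.log_succ_self hS] at hnot
          unfold Protocol.receive at hnot ⊢
          split_ifs at hnot ⊢ with h1
          · rfl
          · dsimp only at hnot ⊢
            split_ifs at hnot ⊢
            · simp at hnot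
            · rfl
      · rw [Protocol.log_succ_ne hS hij]
        rcases hr : restrict S A B t with _ | ⟨j', a'⟩
        · rw [Protocol.log_succ_none (ht'.trans hr), ih']
        · have h1 := (restrict_eq_some.1 hr).1
          rw [hS] at h1
          cases h1
          rw [Protocol.log_succ_ne (ht'.trans hr) hij, ih']

/-- The corrupted nodes and the nodes in `A` can produce everything that the restricted execution
needs. -/
theorem Protocol.available_restrict (hS : P.Admissible ∅ ω m S)
    (hB : ∀ t i b, b.signer ∈ B → Item.ack b ∉ P.log ω S t i)
    (h₀ : ∀ i ∈ A, P.log ω S' T₀ i = []) (hS' : ∀ t < T, S' (T₀ + t) = restrict S A B t)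
    (hF : P.sender ∈ F) (hcover : ∀ i, i ∉ F → i ∈ A ∨ i ∈ B)
    (ht : t < T) (h : S' (T₀ + t) = some (j, a)) : P.Available F ω S' m' (T₀ + t) a := by
  rw [hS' t ht, restrict_eq_some] at h
  obtain ⟨hSt, -, ha⟩ := h
  have hacked : ∀ b : Ack n K M, b.signer ∉ B → P.Acked ω S t b.signer b.comm b.msg →
      b.signer ∉ F → P.Acked ω S' (T₀ + t) b.signer b.comm b.msg := by
    rintro b hbB ⟨s, hs, hb⟩ hbF
    have hbA := (hcover _ hbF).resolve_right hbB
    refine ⟨T₀ + s, by omega, ?_⟩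
    rwa [Protocol.log_restrict hB (h₀ _ hbA) hS' hbA (by omega)]
  have hav := hS.1 t j a hSt
  cases a with
  | prop k m₁ E =>
    refine ⟨fun h => absurd hF h, fun b hb => hacked b (fun hbB => ?_)
      (hav.2 b hb (Finset.notMem_empty _))⟩
    -- The proposal comes from the honest sender of `S`, whose evidence consists of accepted
    -- acknowledgments, hence of none by `B`.
    obtain ⟨-, s, -, hE⟩ := hav.prop_eq
    exact hB s _ b hbB (P.propose_known _ _ _ _ _ hE b hb)
  | ack b => exact hacked b (ha b rfl) (hav (Finset.notMem_empty _))

/-- The attack: two executions with honest nodes only, in which the nodes in `B` and those in `A`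
are late, are merged into one with a corrupted sender. -/
theorem Protocol.exists_not_reliable {m₁ m₂ : M} {S₁ S₂ : Schedule n K M} {x y : Fin n}
    (hF : P.sender ∈ F) (hcover : ∀ i, i ∉ F → i ∈ A ∨ i ∈ B) (hAB : Disjoint A B)
    (hAF : Disjoint A F) (hBF : Disjoint B F) (hm : m₁ ≠ m₂)
    (h₁ : P.Admissible ∅ ω m₁ S₁) (hB : ∀ t i b, b.signer ∈ B → Item.ack b ∉ P.log ω S₁ t i)
    (h₂ : P.Admissible ∅ ω m₂ S₂) (hA : ∀ t i b, b.signer ∈ A → Item.ack b ∉ P.log ω S₂ t i)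
    (hx : x ∈ A) (hxd : P.Delivers ω S₁ m₁ x m₁) (hy : y ∈ B) (hyd : P.Delivers ω S₂ m₂ y m₂)
    (m : M) : ∃ S, P.Admissible F ω m S ∧ ¬ P.Reliable F ω m S := by
  obtain ⟨T₁, hxd⟩ := hxd
  obtain ⟨T₂, hyd⟩ := hyd
  have hxF := Finset.disjoint_left.1 hAF hx
  have hyF := Finset.disjoint_left.1 hBF hy
  have hinput : ∀ i, i ∉ F → ∀ m', P.input m' i = none := by
    intro i hi m'
    exact if_neg (by rintro rfl; exact hi hF)
  -- The prefixes run one after the other. During the first `T₁` steps nothing reaches `B`, so its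
  -- nodes enter the second prefix with empty logs; by then `x` has already delivered.
  let S₀ : Schedule n K M := fun t =>
    if t < T₁ then restrict S₁ A B t else restrict S₂ B A (t - T₁)
  have e₁ : ∀ t < T₁, S₀ (0 + t) = restrict S₁ A B t := by
    intro t ht
    simp [S₀, ht]
  have e₂ : ∀ t < T₂, S₀ (T₁ + t) = restrict S₂ B A t := by
    intro t ht
    simp [S₀]
  have hnil₁ : ∀ i ∈ A, P.log ω S₀ 0 i = [] := fun i _ => rfl
  have hnil₂ : ∀ i ∈ B, P.log ω S₀ T₁ i = [] := by
    refine fun i hi => Protocol.log_eq_nil fun t ht a h => ?_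
    simp only [S₀, if_pos ht] at h
    exact Finset.disjoint_left.1 hAB (restrict_eq_some.1 h).2.1 hi
  obtain ⟨S, hS, hSS₀⟩ := P.exists_admissible_extension ω m F S₀ (T₁ + T₂) (by
    intro t ht j a h
    rcases lt_or_ge t T₁ with ht₁ | ht₁
    · have := Protocol.available_restrict (T₀ := 0) (m' := m) h₁ hB hnil₁ e₁ hF hcover ht₁
        (by simpa using h)
      simpa using this
    · obtain ⟨s, rfl⟩ := Nat.exists_eq_add_of_le ht₁
      exact Protocol.available_restrict h₂ hA hnil₂ e₂ hF (fun i hi => (hcover i hi).symm)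
        (by omega) h)
  refine ⟨S, hS, fun hrel => hm (hrel.agreement x y m₁ m₂ hxF hyF ?_ ⟨T₁, ?_⟩ ⟨T₁ + T₂, ?_⟩)⟩
  · rintro rfl
    exact Finset.disjoint_left.1 hAB hx hy
  · have h := Protocol.log_restrict hB (hnil₁ x hx) e₁ hx le_rfl
    rw [zero_add] at h
    rw [Protocol.log_congr fun s hs => hSS₀ s (by omega), h, hinput x hxF]
    rwa [hinput x hxF] at hxd
  · have h := Protocol.log_restrict hA (hnil₂ y hy) e₂ hy le_rfl
    rw [Protocol.log_congr hSS₀, h, hinput y hyF]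
    rwa [hinput y hyF] at hyd

/-- With high probability, the sender's input is delivered by everybody in an execution without
corrupted nodes in which acknowledgments of `L` are never accepted. -/
theorem Protocol.IsProbabilisticBRB.late {f : ℕ} {ε : ℝ} (hP : P.IsProbabilisticBRB f ε)
    (m : M) (L : Finset (Fin n)) : ∃ R : Set (Seed n nc K), 1 - ε ≤ prob R ∧
      ∀ ω ∈ R, (∀ k, nc < 2 * ((ω k).1 \ L).card) → ∃ S, P.Admissible ∅ ω m S ∧
        (∀ t i b, b.signer ∈ L → Item.ack b ∉ P.log ω S t i) ∧ ∀ i, P.Delivers ω S m i m := by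
  have h : ∀ ω : Seed n nc K, ∃ S, P.Admissible ∅ ω m S ∧
      ((∀ k, nc < 2 * ((ω k).1 \ L).card) →
        ∀ t i b, b.signer ∈ L → Item.ack b ∉ P.log ω S t i) := by
    intro ω
    by_cases hL : ∀ k, nc < 2 * ((ω k).1 \ L).card
    · obtain ⟨S, h1, h2⟩ := P.exists_admissible_late ω m L hL
      exact ⟨S, h1, fun _ => h2⟩
    -- An adversary must act on every seed; where the delay is impossible, any admissible schedule
    -- will do.
    · obtain ⟨S, h1⟩ := P.exists_admissible ω m ∅
      exact ⟨S, h1, fun h => absurd h hL⟩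
  choose S hS hlate using h
  exact ⟨_, hP ∅ (by simp) m S hS, fun ω hω hL => ⟨S ω, hS ω, hlate ω hL, fun i =>
    hω.validity (Finset.notMem_empty _) i (Finset.notMem_empty _)⟩⟩

/-- The protocol's guarantee is used three times: with nobody corrupted for inputs `m₁` and `m₂`,
and with `F` corrupted. The union bound then produces a seed on which the attack succeeds and yet
the execution is reliable. -/
theorem Protocol.not_isProbabilisticBRB [Nontrivial M] {f : ℕ} {ε δ : ℝ}
    (P : Protocol (3 * f + 1) nc K M) (hε : ε < 1 / 5) (hδ : 0 ≤ δ) (hδε : 5 * ε + δ / 4 < 1)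
    (hnc : (nc : ℝ) ≤ δ * (f - nc)) (hncf : nc < f) (hmaj : HonestMajority (3 * f + 1) nc K f ε) :
    ¬ P.IsProbabilisticBRB f ε := by
  intro hP
  obtain ⟨m₁, m₂, hm⟩ := exists_pair_ne M
  obtain ⟨F, hsF, -, hF⟩ := Finset.exists_subsuperset_card_eq
    (Finset.subset_univ {P.sender}) (n := f) (by simp; omega) (by simp; omega)
  rw [Finset.singleton_subset_iff] at hsF
  obtain ⟨B, hBF, hB⟩ := Finset.exists_subset_card_eq (s := Fᶜ) (n := f)
    (by rw [Finset.card_compl, hF, Fintype.card_fin]; omega)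
  obtain ⟨A, hA⟩ : ∃ A, A = (F ∪ B)ᶜ := ⟨_, rfl⟩
  have hFB : Disjoint F B :=
    Finset.disjoint_left.2 fun i hi hiB => Finset.mem_compl.1 (hBF hiB) hi
  have hAcard : A.card = f + 1 := by
    rw [hA, Finset.card_compl, Finset.card_union_of_disjoint hFB, hF, hB, Fintype.card_fin]
    omega
  have hmemA : ∀ i, i ∈ A ↔ i ∉ F ∧ i ∉ B := by
    intro i
    simp [hA]
  obtain ⟨x, hx⟩ := Finset.card_pos.1 (by omega : 0 < A.card)
  obtain ⟨y, hy⟩ := Finset.card_pos.1 (by omega : 0 < B.card)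
  -- The hypothesis covers only `f` nodes: it is applied to `A` without `x`, and `x` is put back at
  -- a cost of `δ / 4`.
  have hgA := le_prob_majority_insert hε (A.erase x) (f := f)
    (by rw [Finset.card_erase_of_mem hx, hAcard]; rfl) x hδ hnc hncf
    (hmaj _ (by rw [Finset.card_erase_of_mem hx, hAcard]; rfl))
  rw [Finset.insert_erase hx] at hgA
  have hgB := hmaj B hB.le
  obtain ⟨R₁, hR₁, h₁⟩ := hP.late m₁ B
  obtain ⟨R₂, hR₂, h₂⟩ := hP.late m₂ A
  set GA := {ω : Seed (3 * f + 1) nc K | ∀ k, nc < 2 * ((ω k).1 \ A).card}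
  set GB := {ω : Seed (3 * f + 1) nc K | ∀ k, nc < 2 * ((ω k).1 \ B).card}
  have hattack : ∀ ω, ∃ S, P.Admissible F ω m₁ S ∧
      (ω ∈ GA ∩ (GB ∩ (R₁ ∩ R₂)) → ¬ P.Reliable F ω m₁ S) := by
    intro ω
    by_cases hω : ω ∈ GA ∩ (GB ∩ (R₁ ∩ R₂))
    · obtain ⟨hωA, hωB, hω₁, hω₂⟩ := hω
      obtain ⟨S₁, hS₁, hB₁, hd₁⟩ := h₁ ω hω₁ hωB
      obtain ⟨S₂, hS₂, hA₂, hd₂⟩ := h₂ ω hω₂ hωA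
      obtain ⟨S, hS, hS'⟩ := Protocol.exists_not_reliable (A := A) hsF
        (fun i hi => by rw [hmemA]; tauto)
        (Finset.disjoint_left.2 fun i hi => ((hmemA i).1 hi).2)
        (Finset.disjoint_left.2 fun i hi => ((hmemA i).1 hi).1) hFB.symm hm hS₁ hB₁ hS₂ hA₂
        hx (hd₁ x) hy (hd₂ y) m₁
      exact ⟨S, hS, fun _ => hS'⟩
    · obtain ⟨S, hS⟩ := P.exists_admissible ω m₁ F
      exact ⟨S, hS, fun h => absurd h hω⟩
  choose S hS hS' using hattack
  have hR := hP F hF.le m₁ S hS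
  set R := {ω : Seed (3 * f + 1) nc K | P.Reliable F ω m₁ (S ω)}
  have hempty : R ∩ (GA ∩ (GB ∩ (R₁ ∩ R₂))) = ∅ := by
    ext ω
    simp only [Set.mem_inter_iff, Set.mem_empty_iff_false, iff_false]
    exact fun h => hS' ω h.2 h.1
  have p1 := prob_add_le R (GA ∩ (GB ∩ (R₁ ∩ R₂)))
  rw [hempty, prob_empty] at p1
  have p2 := prob_add_le GA (GB ∩ (R₁ ∩ R₂))
  have p3 := prob_add_le GB (R₁ ∩ R₂)
  have p4 := prob_add_le R₁ R₂
  linarith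

end Attack

end CommitteeBRB

/-! ### Choice of constants -/

theorem mainTheorem9 {M : Type*} [Nontrivial M] (nc : ℕ → ℕ)
    (hnc : (fun f : ℕ => (nc f : ℝ)) =o[atTop] (fun f : ℕ => ((3 * f + 1 : ℕ) : ℝ)))
    (ε : ℝ) (hε : ε < 1 / 5) :
    ∀ᶠ f : ℕ in atTop, ∀ K : ℕ, CommitteeBRB.HonestMajority (3 * f + 1) (nc f) K f ε →
      ¬ ∃ P : CommitteeBRB.Protocol (3 * f + 1) (nc f) K M, P.IsProbabilisticBRB f ε := by
  obtain ⟨δ, hδ0, hδ1, hδε⟩ : ∃ δ : ℝ, 0 < δ ∧ δ ≤ 1 ∧ 5 * ε + δ / 4 < 1 :=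
    ⟨min 1 (1 - 5 * ε), lt_min one_pos (by linarith), min_le_left _ _, by
      linarith [min_le_right 1 (1 - 5 * ε)]⟩
  -- For `f ≥ 1`, `δ / 8 * (3 * f + 1) ≤ δ * f / 2`; as `δ ≤ 1`, also `nc f ≤ f / 2`, hence `f - nc
  -- f ≥ f / 2` and `nc f ≤ δ * (f - nc f)`.
  filter_upwards [hnc.def (c := δ / 8) (by positivity), eventually_ge_atTop 1] with f hf hf1 K hmaj
  rintro ⟨P, hP⟩
  have hf1' : (1 : ℝ) ≤ f := by exact_mod_cast hf1
  rw [Real.norm_natCast, Real.norm_natCast] at hf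
  push_cast at hf
  have hle : (nc f : ℝ) ≤ δ * (f / 2) := by nlinarith
  have hhalf : (nc f : ℝ) ≤ f / 2 := by nlinarith
  refine P.not_isProbabilisticBRB hε hδ0.le hδε ?_ ?_ hmaj hP
  · nlinarith
  · have : (nc f : ℝ) < f := by linarith
    exact_mod_cast this
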